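/- For an integer $t\ge 0$ define the $q$-series $$\mathcal U_{2t}(q)=\sum_{1\le k_1<\cdots<k_t}\frac{q^{k_1+\cdots+k_t}}{(1-q^{k_1})^2\cdots(1-q^{k_t})^2},\qquad \mathcal U^{\star}_{2t}(q)=\sum_{1\le k_1\le\cdots\le k_t}\frac{q^{k_1+\cdots+k_t}}{(1-q^{k_1})^2\cdots(1-q^{k_t})^2},$$ $$\mathcal C_{2t}(q)=\sum_{0<s_1<\cdots<s_t}\frac{q^{2s_1+\cdots+2s_t-t}}{(1-q^{2s_1-1})^2\cdots(1-q^{2s_t-1})^2}$$ (so that each of them is $1$ for $t=0$), and write $(a;q)_\infty=(1-a)(1-aq)(1-aq^2)\cdots$ and $(q)_\infty=(q;q)_\infty$. Then $$\sum_{t\ge0}\mathcal U_{2t}(q)=\frac{(q^6)_\infty}{(q)_\infty(q^2)_\infty(q^3)_\infty},\qquad \sum_{t\ge0}\mathcal C_{2t}(q)=\frac{(q^4)_\infty(q^6)_\infty^2}{(q)_\infty(q^3)_\infty(q^{12})_\infty},$$ $$\sum_{t\ge0}\mathcal U^{\star}_{2t}(q)=\sum_{n\ge1}\frac{(-1)^{n-1}(1-q^n)(1-q^{2n})\,q^{\binom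 n2}}{1-3q^n+q^{2n}}.$$ These three identities hold in the ring $\mathbb Z[[q]]$ of formal power series, all infinite sums and products converging there coefficientwise. They also hold for complex numbers $q$ with $|q|<1$, all infinite sums and products being convergent, where for the third identity one assumes in addition that $|q^n|<|1-q^n|^2$ for every $n\ge1$ (this makes the sum over $t$ converge). -/

import Mathlib

open scoped PowerSeries PowerSeries.WithPiTopology

/-!
All series below are defined in an arbitrary commutative topological ring `R`, for an element `q` of
`R`, so that the same definitions serve for `q` the variable of `ℤ⟦X⟧` (with the topology of
coefficientwise convergence, `ℤ` being discrete) and for `q` a complex number.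
`Ring.inverse x` is the inverse of `x` when `x` is a unit; in a field it is `x⁻¹`.
-/

namespace MacMahon

variable {R : Type*} [CommRing R]

/-- The summand `q^(k₁+⋯+k_t) / ((1-q^{k₁})²⋯(1-q^{k_t})²)`. -/
noncomputable def uTerm (q : R) {t : ℕ} (k : Fin t → ℕ+) : R :=
  q ^ (∑ i, (k i : ℕ)) * Ring.inverse (∏ i, (1 - q ^ (k i : ℕ)) ^ 2)

/-- The summand `q^(2s₁+⋯+2s_t-t) / ((1-q^{2s₁-1})²⋯(1-q^{2s_t-1})²)`; the natural subtractions do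
not truncate, as every `sᵢ` is at least `1`. -/
noncomputable def cTerm (q : R) {t : ℕ} (s : Fin t → ℕ+) : R :=
  q ^ ((∑ i, 2 * (s i : ℕ)) - t) * Ring.inverse (∏ i, (1 - q ^ (2 * (s i : ℕ) - 1)) ^ 2)

/-- The summand `(-1)^{n-1} (1-q^n) (1-q^{2n}) q^{n(n-1)/2} / (1-3q^n+q^{2n})`. -/
noncomputable def starTerm (q : R) (n : ℕ+) : R :=
  (-1) ^ ((n : ℕ) - 1) * (1 - q ^ (n : ℕ)) * (1 - q ^ (2 * (n : ℕ))) * q ^ ((n : ℕ).choose 2) *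
    Ring.inverse (1 - 3 * q ^ (n : ℕ) + q ^ (2 * (n : ℕ)))

variable [TopologicalSpace R]

/-- MacMahon's `𝒰_{2t}(q)`: the sum over all chains `1 ≤ k₁ < ⋯ < k_t`. -/
noncomputable def U (t : ℕ) (q : R) : R :=
  ∑' k : {k : Fin t → ℕ+ // StrictMono k}, uTerm q k.1

/-- MacMahon's `𝒞_{2t}(q)`: the sum over all chains `0 < s₁ < ⋯ < s_t`. -/
noncomputable def C (t : ℕ) (q : R) : R :=
  ∑' s : {s : Fin t → ℕ+ // StrictMono s}, cTerm q s.1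

/-- The series `𝒰⋆_{2t}(q)`: the sum over all weak chains `1 ≤ k₁ ≤ ⋯ ≤ k_t`. -/
noncomputable def UStar (t : ℕ) (q : R) : R :=
  ∑' k : {k : Fin t → ℕ+ // Monotone k}, uTerm q k.1

/-- `(a;q)_∞ = (1-a)(1-aq)(1-aq²)⋯`. -/
noncomputable def qPoch (a q : R) : R :=
  ∏' n : ℕ, (1 - a * q ^ n)

/-- The short-hand `(q)_∞ = (q;q)_∞`. -/
noncomputable def euler (q : R) : R :=
  qPoch q q

end MacMahon

/-! Put `x_n = q^n/(1-q^n)^2`. The summands of `U`, `C` and `UStar` are products of the `x_n`, so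
summing over `t` gives a sum over all finite sets, or over all multisets, of indices: `∏ (1 + x_n)`
over all `n` for `U`, over odd `n` for `C`, and `∏ 1/(1 - x_n)` for `UStar` (`hasSum_strictChain`,
`hasSum_weakChain`).

With `y = q^n`, `1 + x_n = (1-y+y^2)/(1-y)^2 = (1-y^6)/((1-y)(1-y^2)(1-y^3))`, which gives the first
two products.

For the third, `1 - x_n = (1-3y+y^2)/(1-y)^2`, and `1-3y+y^2` is `y` times the difference of the
node `y + y⁻¹` and `3`. Evaluating at `3` the Lagrange interpolation of the constant `1` at the
first `N` nodes expands the `N`-th partial product in partial fractions (`sum_partialFraction`). As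
`N → ∞` the extra coefficients `(q)_N^2/((q)_{N-1-i} (q)_{N+i+1})` tend to `1` and stay bounded, so
dominated convergence yields the series (`tprod_inverse_one_sub_ratio`).

The `X`-adic norm on `ℤ⟦X⟧` induces coefficientwise convergence, so one argument in a complete
normed domain with `‖q‖ < 1` covers both settings. -/

namespace MacMahon

/-! ### The `X`-adic norm on `ℤ⟦X⟧`. -/

open scoped Classical in
/-- The norm `2 ^ (- order f)`. -/
noncomputable def orderNorm (f : ℤ⟦X⟧) : ℝ :=
  if f = 0 then 0 else (1 / 2 : ℝ) ^ f.order.toNat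

theorem orderNorm_nonneg (f : ℤ⟦X⟧) : 0 ≤ orderNorm f := by
  unfold orderNorm; split_ifs <;> positivity

theorem orderNorm_le_iff (f : ℤ⟦X⟧) (n : ℕ) :
    orderNorm f ≤ (1 / 2 : ℝ) ^ n ↔ ∀ i < n, PowerSeries.coeff i f = 0 := by
  unfold orderNorm
  split_ifs with h
  · simp [h]
  · rw [pow_le_pow_iff_right_of_lt_one₀ (by norm_num) (by norm_num)]
    have h1 : (f.order.toNat : ℕ∞) = f.order := PowerSeries.coe_toNat_order h
    rw [← Nat.cast_le (α := ℕ∞), h1]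
    exact ⟨fun hn i hi => PowerSeries.coeff_of_lt_order i
      (lt_of_lt_of_le (by exact_mod_cast hi) hn), fun H => PowerSeries.nat_le_order f n H⟩

theorem orderNorm_lt_iff (f : ℤ⟦X⟧) (n : ℕ) :
    orderNorm f < (1 / 2 : ℝ) ^ n ↔ ∀ i ≤ n, PowerSeries.coeff i f = 0 := by
  have : orderNorm f < (1 / 2 : ℝ) ^ n ↔ orderNorm f ≤ (1 / 2 : ℝ) ^ (n + 1) := by
    unfold orderNorm
    split_ifs with h
    · simp
    · rw [pow_lt_pow_iff_right_of_lt_one₀ (by norm_num) (by norm_num),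
        pow_le_pow_iff_right_of_lt_one₀ (by norm_num) (by norm_num), Nat.succ_le_iff]
  rw [this, orderNorm_le_iff]
  simp only [Nat.lt_succ_iff]

theorem orderNorm_eq_zero {f : ℤ⟦X⟧} (h : orderNorm f = 0) : f = 0 := by
  by_contra hf
  rw [orderNorm, if_neg hf] at h
  exact (pow_pos (by norm_num : (0 : ℝ) < 1 / 2) _).ne' h

theorem orderNorm_neg (f : ℤ⟦X⟧) : orderNorm (-f) = orderNorm f := by
  by_cases hf : f = 0
  · rw [hf, neg_zero]
  · rw [orderNorm, orderNorm, if_neg hf, if_neg (neg_ne_zero.2 hf), PowerSeries.order_neg]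

theorem orderNorm_mul (f g : ℤ⟦X⟧) : orderNorm (f * g) = orderNorm f * orderNorm g := by
  unfold orderNorm
  by_cases hf : f = 0
  · simp [hf]
  by_cases hg : g = 0
  · simp [hg]
  rw [if_neg (mul_ne_zero hf hg), if_neg hf, if_neg hg, ← pow_add, PowerSeries.order_mul,
    ENat.toNat_add (by simpa using hf) (by simpa using hg)]

theorem orderNorm_add_le (f g : ℤ⟦X⟧) : orderNorm (f + g) ≤ orderNorm f + orderNorm g := by
  by_cases hf : f = 0
  · simpa [hf] using orderNorm_nonneg 0
  by_cases hg : g = 0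
  · simpa [hg] using orderNorm_nonneg 0
  have key : ∀ n : ℕ, orderNorm f ≤ (1 / 2 : ℝ) ^ n → orderNorm g ≤ (1 / 2 : ℝ) ^ n →
      orderNorm (f + g) ≤ (1 / 2 : ℝ) ^ n := by
    intro n h1 h2
    rw [orderNorm_le_iff] at *
    intro i hi
    rw [map_add, h1 i hi, h2 i hi, add_zero]
  have ef : orderNorm f = (1 / 2 : ℝ) ^ f.order.toNat := if_neg hf
  have eg : orderNorm g = (1 / 2 : ℝ) ^ g.order.toNat := if_neg hg
  rcases le_total (orderNorm f) (orderNorm g) with h | h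
  · exact (key _ (h.trans eg.le) eg.le).trans
      (by rw [← eg]; linarith [orderNorm_nonneg f])
  · exact (key _ ef.le (h.trans ef.le)).trans
      (by rw [← ef]; linarith [orderNorm_nonneg g])

-- Being closer than a power of `1/2` constrains only finitely many coefficients, and `ℤ` is
-- discrete; conversely a small enough ball fixes any given coefficient. This lets the norm be put
-- on the existing uniform structure.
open Filter Topology in
theorem uniformity_eq_orderNorm :
    uniformity ℤ⟦X⟧ = ⨅ ε > (0 : ℝ), 𝓟 {p : ℤ⟦X⟧ × ℤ⟦X⟧ | orderNorm (-p.1 + p.2) < ε} := by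
  apply le_antisymm
  · refine le_iInf₂ fun ε hε => le_principal_iff.2 ?_
    obtain ⟨n, hn⟩ := exists_pow_lt_of_lt_one hε (by norm_num : (1 / 2 : ℝ) < 1)
    have h : ∀ i ∈ Finset.range n, ∀ᶠ p : ℤ⟦X⟧ × ℤ⟦X⟧ in uniformity ℤ⟦X⟧,
        PowerSeries.coeff i p.1 = PowerSeries.coeff i p.2 := by
      intro i _
      have := PowerSeries.WithPiTopology.uniformContinuous_coeff (R := ℤ) i
      have h2 : {p : ℤ × ℤ | p.1 = p.2} ∈ uniformity ℤ := by
        have : SetRel.id ∈ uniformity ℤ := by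
          rw [DiscreteUniformity.eq_principal_setRelId]; exact mem_principal_self _
        exact this
      exact this h2
    filter_upwards [(Filter.eventually_all_finset _).2 h] with p hp
    refine lt_of_le_of_lt ((orderNorm_le_iff _ n).2 fun i hi => ?_) hn
    rw [map_add, map_neg, hp i (Finset.mem_range.2 hi), neg_add_cancel]
  · have : uniformity ℤ⟦X⟧ = ⨅ d : Unit →₀ ℕ,
        comap (fun p : ℤ⟦X⟧ × ℤ⟦X⟧ => (p.1 d, p.2 d)) (uniformity ℤ) :=
      Pi.uniformity (fun _ : Unit →₀ ℕ => ℤ)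
    rw [this]
    refine le_iInf fun d => ?_
    intro s hs
    obtain ⟨V, hV, hVs⟩ := hs
    refine mem_iInf_of_mem ((1 / 2 : ℝ) ^ (d ())) (mem_iInf_of_mem (by positivity) ?_)
    rw [mem_principal]
    intro p hp
    have h0 := (orderNorm_lt_iff _ _).1 hp (d ()) le_rfl
    have hd : Finsupp.single () (d ()) = d := by ext; simp
    have h1 : p.1 d = p.2 d := by
      rw [map_add, map_neg, neg_add_eq_zero] at h0
      rw [PowerSeries.coeff, hd] at h0
      exact h0
    refine hVs ?_
    rw [Set.mem_preimage, h1]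
    exact refl_mem_uniformity hV

/-- The power series ring with the `X`-adic norm; its topology is, by definition, that of
coefficientwise convergence. -/
@[reducible] noncomputable def normedPowerSeries : NormedCommRing ℤ⟦X⟧ where
  __ := (inferInstance : CommRing ℤ⟦X⟧)
  norm := orderNorm
  dist f g := orderNorm (-f + g)
  dist_self f := by simp [orderNorm]
  dist_comm f g := by rw [← orderNorm_neg]; congr 1; ring
  dist_triangle f g h := by
    have := orderNorm_add_le (-f + g) (-g + h)
    rwa [show -f + g + (-g + h) = -f + h by ring] at this
  eq_of_dist_eq_zero {f g} h := by
    have := orderNorm_eq_zero h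
    linear_combination -this
  toUniformSpace := PowerSeries.WithPiTopology.instUniformSpace ℤ
  uniformity_dist := uniformity_eq_orderNorm
  dist_eq _ _ := rfl
  norm_mul_le f g := (orderNorm_mul f g).le

open Finset Filter Topology

/-! ### Sums over multisets and products of geometric series. -/

section Multiset
variable {R ι : Type*} [NormedCommRing R]

theorem hasSum_inverse_one_sub [CompleteSpace R] {x : R} (hx : ‖x‖ < 1) :
    HasSum (fun n : ℕ => x ^ n) (Ring.inverse (1 - x)) := by
  have h := (summable_geometric_of_norm_lt_one hx)
  convert h.hasSum using 1
  rw [NormedRing.inverse_one_sub x hx]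
  rfl

/-- Adding copies of a new element to the multisets supported in `K`. -/
noncomputable def multisetInsertEquiv [DecidableEq ι] (K : Finset ι) (a : ι) (ha : a ∉ K) :
    ℕ × {m : Multiset ι // ∀ k ∈ m, k ∈ K} ≃ {m : Multiset ι // ∀ k ∈ m, k ∈ insert a K} :=
  Equiv.ofBijective
    (fun p => ⟨Multiset.replicate p.1 a + p.2.1, by
      intro k hk
      rcases Multiset.mem_add.1 hk with h | h
      · rw [Multiset.eq_of_mem_replicate h]; exact mem_insert_self _ _
      · exact mem_insert_of_mem (p.2.2 k h)⟩) (by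
    constructor
    · rintro ⟨n, m, hm⟩ ⟨n', m', hm'⟩ h
      have h1 : Multiset.replicate n a + m = Multiset.replicate n' a + m' :=
        congrArg Subtype.val h
      have e := congrArg (Multiset.count a) h1
      have z : ∀ l : Multiset ι, (∀ k ∈ l, k ∈ K) → l.count a = 0 := fun l hl =>
        Multiset.count_eq_zero_of_notMem fun hal => ha (hl a hal)
      rw [Multiset.count_add, Multiset.count_add, z m hm, z m' hm',
        Multiset.count_replicate_self, Multiset.count_replicate_self] at e
      obtain rfl : n = n' := by simpa using e
      obtain rfl := add_left_cancel h1
      rfl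
    · rintro ⟨m, hm⟩
      refine ⟨⟨m.count a, m.filter (fun k => ¬ k = a), fun k hk => ?_⟩, ?_⟩
      · rw [Multiset.mem_filter] at hk
        exact (mem_insert.1 (hm k hk.1)).resolve_left hk.2
      · apply Subtype.ext
        change Multiset.replicate (m.count a) a + m.filter (fun k => ¬ k = a) = m
        rw [← Multiset.filter_eq', Multiset.filter_add_not])

theorem coe_multisetInsertEquiv [DecidableEq ι] (K : Finset ι) (a : ι) (ha : a ∉ K)
    (p : ℕ × {m : Multiset ι // ∀ k ∈ m, k ∈ K}) :
    (multisetInsertEquiv K a ha p : Multiset ι) = Multiset.replicate p.1 a + p.2.1 := rfl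

/-- Induction on `K`: a new element contributes its multiplicity, hence a geometric series. Norm
summability is carried along to justify the Cauchy product. -/
theorem hasSum_multiset_of_finset [CompleteSpace R] (x : ι → R) (hx : ∀ k, ‖x k‖ < 1) (K : Finset ι) :
    Summable (fun m : {m : Multiset ι // ∀ k ∈ m, k ∈ K} => ‖(m.1.map x).prod‖) ∧
    HasSum (fun m : {m : Multiset ι // ∀ k ∈ m, k ∈ K} => (m.1.map x).prod)
      (∏ k ∈ K, Ring.inverse (1 - x k)) := by
  classical
  induction K using Finset.induction_on with
  | empty =>
    have : Unique {m : Multiset ι // ∀ k ∈ m, k ∈ (∅ : Finset ι)} :=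
      ⟨⟨⟨0, by simp⟩⟩, fun m => Subtype.ext
        (Multiset.eq_zero_of_forall_notMem fun k hk => by simpa using m.2 k hk)⟩
    have h0 : (default : {m : Multiset ι // ∀ k ∈ m, k ∈ (∅ : Finset ι)}).1 = 0 :=
      Multiset.eq_zero_of_forall_notMem fun k hk => by
        simpa using (default : {m : Multiset ι // ∀ k ∈ m, k ∈ (∅ : Finset ι)}).2 k hk
    refine ⟨Summable.of_finite, ?_⟩
    convert! hasSum_unique _ using 1
    rw [h0]; simp
  | insert a K ha ih =>
    have g := summable_norm_geometric_of_norm_lt_one (hx a)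
    have hs := g.mul_norm ih.1
    rw [← (multisetInsertEquiv K a ha).summable_iff, ← (multisetInsertEquiv K a ha).hasSum_iff,
      prod_insert ha]
    have e : (fun m : {m : Multiset ι // ∀ k ∈ m, k ∈ insert a K} => (m.1.map x).prod) ∘
        multisetInsertEquiv K a ha = fun p => x a ^ p.1 * (p.2.1.map x).prod := by
      funext p
      rw [Function.comp_apply, coe_multisetInsertEquiv, Multiset.map_add, Multiset.prod_add,
        Multiset.map_replicate, Multiset.prod_replicate]
    constructor
    · refine hs.congr fun p => ?_
      exact congrArg norm (congrFun e p).symm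
    · have hn : Summable fun p : ℕ × {m : Multiset ι // ∀ k ∈ m, k ∈ K} =>
          x a ^ p.1 * (p.2.1.map x).prod := Summable.of_norm hs
      rw [e]
      exact HasSum.mul (f := fun n : ℕ => x a ^ n)
        (g := fun m : {m : Multiset ι // ∀ k ∈ m, k ∈ K} => (m.1.map x).prod)
        (hasSum_inverse_one_sub (hx a)) ih.2 hn

/-- A finite family of multisets lives on a finite support `K`, so its sum is at most `∏ 1/(1-‖x
k‖)` over `K`; `1 + u ≤ exp u` bounds this uniformly in `K`. -/
theorem summable_norm_multiset_prod [NormOneClass R] (x : ι → R) (hx : ∀ k, ‖x k‖ < 1)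
    (hs : Summable fun k => ‖x k‖) :
    Summable (fun m : Multiset ι => ‖(m.map x).prod‖) := by
  classical
  -- Here `1/(1-a) - 1 = a/(1-a) ≤ 2a` once `a < 1/2`, which holds for all but finitely many `k`.
  have hs' : Summable fun k => Ring.inverse (1 - ‖x k‖) - 1 := by
    have h2 : ∀ᶠ k in cofinite, ‖x k‖ < 1 / 2 :=
      hs.tendsto_cofinite_zero.eventually_lt_const (by norm_num)
    refine Summable.of_norm_bounded_eventually (hs.mul_left 2) ?_
    filter_upwards [h2] with k hk
    have h0 := norm_nonneg (x k)
    have e : Ring.inverse (1 - ‖x k‖) - 1 = ‖x k‖ / (1 - ‖x k‖) := by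
      rw [Ring.inverse_eq_inv']; field_simp [(by linarith : 1 - ‖x k‖ ≠ 0)]; ring
    rw [e, Real.norm_of_nonneg (div_nonneg h0 (by linarith)), div_le_iff₀ (by linarith)]
    nlinarith
  have hpos : ∀ k, 0 ≤ Ring.inverse (1 - ‖x k‖) - 1 := by
    intro k
    have h0 := norm_nonneg (x k)
    rw [Ring.inverse_eq_inv', sub_nonneg]
    exact (one_le_inv₀ (by linarith [hx k])).2 (by linarith)
  refine summable_of_sum_le (c := Real.exp (∑' k, (Ring.inverse (1 - ‖x k‖) - 1)))
    (fun _ => norm_nonneg _) fun S => ?_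
  set K : Finset ι := S.biUnion Multiset.toFinset with hK
  have hA := (hasSum_multiset_of_finset (fun k => ‖x k‖) (by simpa using hx) K).2
  have hSK : ∀ m ∈ S, ∀ k ∈ m, k ∈ K := fun m hm k hk =>
    mem_biUnion.2 ⟨m, hm, Multiset.mem_toFinset.2 hk⟩
  have hle : ∀ m : Multiset ι, ‖(m.map x).prod‖ ≤ (m.map fun k => ‖x k‖).prod := by
    intro m
    induction m using Multiset.induction_on with
    | empty => simp
    | cons a m ih =>
      simp only [Multiset.map_cons, Multiset.prod_cons]
      exact (norm_mul_le _ _).trans (by gcongr)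
  have hnn : ∀ m : Multiset ι, 0 ≤ (m.map fun k => ‖x k‖).prod := fun m =>
    (norm_nonneg _).trans (hle m)
  calc ∑ m ∈ S, ‖(m.map x).prod‖ ≤ ∑ m ∈ S, (m.map fun k => ‖x k‖).prod :=
        sum_le_sum fun m _ => hle m
    _ = ∑ m ∈ S.subtype (fun m => ∀ k ∈ m, k ∈ K), (m.1.map fun k => ‖x k‖).prod := by
        rw [sum_subtype_of_mem (fun m : Multiset ι => (m.map fun k => ‖x k‖).prod) hSK]
    _ ≤ ∏ k ∈ K, Ring.inverse (1 - ‖x k‖) := sum_le_hasSum _ (fun m _ => hnn m.1) hA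
    _ ≤ ∏ k ∈ K, Real.exp (Ring.inverse (1 - ‖x k‖) - 1) := by
        refine prod_le_prod (fun k _ => by linarith [hpos k]) fun k _ => ?_
        linarith [Real.add_one_le_exp (Ring.inverse (1 - ‖x k‖) - 1)]
    _ = Real.exp (∑ k ∈ K, (Ring.inverse (1 - ‖x k‖) - 1)) := (Real.exp_sum _ _).symm
    _ ≤ _ := Real.exp_le_exp.2 (hs'.sum_le_tsum _ fun k _ => hpos k)

/-- A sum over all multisets of products is an infinite product of geometric series. -/
theorem hasProd_inverse_one_sub [CompleteSpace R] [NormOneClass R] (x : ι → R) (hx : ∀ k, ‖x k‖ < 1)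
    (hs : Summable fun k => ‖x k‖) :
    HasProd (fun k => Ring.inverse (1 - x k)) (∑' m : Multiset ι, (m.map x).prod) := by
  classical
  -- The partial product over `K` is the sum over multisets supported in `K`; every multiset is
  -- eventually included, and the full sum dominates.
  have key : Tendsto (fun K : Finset ι => ∑' m : Multiset ι,
      Set.indicator {m : Multiset ι | ∀ k ∈ m, k ∈ K} (fun m => (m.map x).prod) m) atTop
      (𝓝 (∑' m : Multiset ι, (m.map x).prod)) := by
    refine tendsto_tsum_of_dominated_convergence (summable_norm_multiset_prod x hx hs)
      (fun m => ?_) (Eventually.of_forall fun K m => norm_indicator_le_norm_self _ _)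
    refine tendsto_const_nhds.congr' ?_
    filter_upwards [eventually_ge_atTop m.toFinset] with K hK
    rw [Set.indicator_of_mem]
    exact fun k hk => hK (Multiset.mem_toFinset.2 hk)
  refine key.congr fun K => ?_
  rw [← _root_.tsum_subtype]
  exact (hasSum_multiset_of_finset x hx K).2.tsum_eq

end Multiset

/-! ### Chains of arbitrary length as finite sets and multisets. -/

section Chains

theorem hasSum_congr_fun {M β : Type*} [AddCommMonoid M] [TopologicalSpace M] {f g : β → M}
    {a : M} (h : HasSum f a) (e : ∀ b, f b = g b) : HasSum g a :=
  (funext e : f = g) ▸ h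

variable {α : Type*} [LinearOrder α]

/-- Weak chains of arbitrary length are multisets. -/
noncomputable def weakChainEquiv : (Σ t : ℕ, {k : Fin t → α // Monotone k}) ≃ Multiset α :=
  Equiv.ofBijective (fun c => (List.ofFn c.2.1 : Multiset α)) (by
    constructor
    · rintro ⟨t, k, hk⟩ ⟨t', k', hk'⟩ h
      have hp : (List.ofFn k).Perm (List.ofFn k') := Multiset.coe_eq_coe.1 h
      obtain rfl : t = t' := by simpa using hp.length_eq
      have := hp.eq_of_pairwise' hk.sortedLE_ofFn.pairwise hk'.sortedLE_ofFn.pairwise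
      obtain rfl := List.ofFn_injective this
      rfl
    · intro m
      refine ⟨⟨(m.sort (· ≤ ·)).length, (m.sort (· ≤ ·)).get, ?_⟩, ?_⟩
      · rw [← List.sortedLE_ofFn_iff, List.ofFn_get]
        exact (Multiset.pairwise_sort _ _).sortedLE
      · exact (congrArg _ (List.ofFn_get _)).trans (Multiset.sort_eq _ _))

theorem weakChainEquiv_apply (c : Σ t : ℕ, {k : Fin t → α // Monotone k}) :
    weakChainEquiv c = (List.ofFn c.2.1 : Multiset α) := rfl

theorem prod_map_weakChainEquiv {M : Type*} [CommMonoid M] (x : α → M)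
    (c : Σ t : ℕ, {k : Fin t → α // Monotone k}) :
    ((weakChainEquiv c).map x).prod = ∏ i, x (c.2.1 i) := by
  rw [weakChainEquiv_apply, Multiset.map_coe, Multiset.prod_coe, List.map_ofFn, List.prod_ofFn]
  rfl

/-- Strict chains of arbitrary length are finite sets. -/
noncomputable def strictChainEquiv : (Σ t : ℕ, {k : Fin t → α // StrictMono k}) ≃ Finset α :=
  Equiv.ofBijective (fun c => univ.map ⟨c.2.1, c.2.2.injective⟩) (by
    constructor
    · rintro ⟨t, k, hk⟩ ⟨t', k', hk'⟩ h
      obtain rfl : t = t' := by simpa using congrArg Finset.card h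
      have : k = k' := by
        rw [← StrictMono.range_inj hk hk']
        simpa using congrArg (fun s : Finset α => (s : Set α)) h
      subst this
      rfl
    · intro s
      refine ⟨⟨s.card, s.orderEmbOfFin rfl, (s.orderEmbOfFin rfl).strictMono⟩, ?_⟩
      apply coe_injective
      simp)

theorem strictChainEquiv_apply (c : Σ t : ℕ, {k : Fin t → α // StrictMono k}) :
    strictChainEquiv c = univ.map ⟨c.2.1, c.2.2.injective⟩ := rfl

theorem prod_strictChainEquiv {M : Type*} [CommMonoid M] (x : α → M)
    (c : Σ t : ℕ, {k : Fin t → α // StrictMono k}) :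
    ∏ k ∈ strictChainEquiv c, x k = ∏ i, x (c.2.1 i) := by
  rw [strictChainEquiv_apply, prod_map]
  rfl

variable {R : Type*} [NormedCommRing R] [NormOneClass R]

theorem summable_norm_strictChain (x : α → R) (hs : Summable fun k => ‖x k‖) :
    Summable fun c : Σ t : ℕ, {k : Fin t → α // StrictMono k} => ‖∏ i, x (c.2.1 i)‖ := by
  have h : Summable fun s : Finset α => ‖∏ i ∈ s, x i‖ :=
    (summable_finsetProd_of_summable_nonneg (fun _ => norm_nonneg _) hs).of_nonneg_of_le
      (fun _ => norm_nonneg _) fun _ => Finset.norm_prod_le _ _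
  rw [← strictChainEquiv.summable_iff] at h
  refine h.congr fun c => ?_
  rw [Function.comp_apply, prod_strictChainEquiv]

theorem hasSum_strictChain [CompleteSpace R] (x : α → R) (hs : Summable fun k => ‖x k‖) :
    HasSum (fun t : ℕ => ∑' k : {k : Fin t → α // StrictMono k}, ∏ i, x (k.1 i))
      (∏' k, (1 + x k)) := by
  have h0 : Summable fun s : Finset α => ∏ k ∈ s, x k := summable_finsetProd_of_summable_norm hs
  have h : HasSum (fun s : Finset α => ∏ k ∈ s, x k) (∏' k, (1 + x k)) := by
    rw [tprod_one_add h0]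
    exact h0.hasSum
  rw [← strictChainEquiv.hasSum_iff] at h
  have h2 : HasSum (fun c : Σ t : ℕ, {k : Fin t → α // StrictMono k} => ∏ i, x (c.2.1 i))
      (∏' k, (1 + x k)) := hasSum_congr_fun h fun c => prod_strictChainEquiv x c
  exact h2.sigma fun t => (((summable_norm_strictChain x hs).comp_injective
    (sigma_mk_injective (i := t))).of_norm).hasSum

theorem summable_norm_weakChain_of_norm_lt_one (x : α → R) (hx : ∀ k, ‖x k‖ < 1)
    (hs : Summable fun k => ‖x k‖) :
    Summable fun c : Σ t : ℕ, {k : Fin t → α // Monotone k} => ‖∏ i, x (c.2.1 i)‖ := by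
  have h := summable_norm_multiset_prod x hx hs
  rw [← weakChainEquiv.summable_iff] at h
  refine h.congr fun c => ?_
  rw [Function.comp_apply, prod_map_weakChainEquiv]

/-- For fixed `t` the products are homogeneous of degree `t`, so rescaling `x` makes all norms less
than `1` at the cost of a constant factor. Thus each single `UStar t q` converges without the bound
`‖x k‖ < 1`. -/
theorem summable_weakChain [CompleteSpace R] (x : α → R) (hs : Summable fun k => ‖x k‖) (t : ℕ) :
    Summable fun k : {k : Fin t → α // Monotone k} => ∏ i, x (k.1 i) := by
  obtain ⟨B, hB⟩ : ∃ B, ∀ k, ‖x k‖ ≤ B :=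
    ⟨∑' k, ‖x k‖, fun k => hs.le_tsum k fun _ _ => norm_nonneg _⟩
  have hB0 : 0 < |B| + 1 := by positivity
  have h := summable_norm_weakChain_of_norm_lt_one (fun k => ‖x k‖ / (|B| + 1))
    (fun k => by
      rw [Real.norm_of_nonneg (by positivity), div_lt_one hB0]
      linarith [hB k, le_abs_self B])
    (by simpa [abs_of_pos hB0] using hs.div_const (|B| + 1))
  have h2 := (h.comp_injective (sigma_mk_injective (i := t))).mul_left ((|B| + 1) ^ t)
  refine Summable.of_norm_bounded h2 fun k => ?_
  refine (Finset.norm_prod_le _ _).trans (le_of_eq ?_)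
  simp only [Function.comp_apply, Real.norm_eq_abs, prod_div_distrib, prod_const, card_univ,
    Fintype.card_fin]
  rw [abs_of_nonneg (div_nonneg (prod_nonneg fun _ _ => norm_nonneg _) (by positivity))]
  field_simp

theorem hasSum_weakChain [CompleteSpace R] (x : α → R) (hx : ∀ k, ‖x k‖ < 1) (hs : Summable fun k => ‖x k‖) :
    HasSum (fun t : ℕ => ∑' k : {k : Fin t → α // Monotone k}, ∏ i, x (k.1 i))
      (∏' k, Ring.inverse (1 - x k)) := by
  have h := (summable_norm_multiset_prod x hx hs).of_norm.hasSum
  rw [← (hasProd_inverse_one_sub x hx hs).tprod_eq, ← weakChainEquiv.hasSum_iff] at h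
  have h2 : HasSum (fun c : Σ t : ℕ, {k : Fin t → α // Monotone k} => ∏ i, x (c.2.1 i))
      (∏' k, Ring.inverse (1 - x k)) := hasSum_congr_fun h fun c => prod_map_weakChainEquiv x c
  exact h2.sigma fun t => (summable_weakChain x hs t).hasSum

end Chains
-- The summands as products of ratios.
theorem injective_two_mul_sub_one : Function.Injective fun s : ℕ+ => 2 * (s : ℕ) - 1 :=
  fun a b h => PNat.coe_injective (by have := a.pos; have := b.pos; simp only at h; omega)

section Inverse
variable {R : Type*} [CommRing R]

theorem inverse_prod {ι : Type*} (s : Finset ι) (f : ι → R) :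
    Ring.inverse (∏ i ∈ s, f i) = ∏ i ∈ s, Ring.inverse (f i) :=
  map_prod (MonoidWithZero.inverse : R →*₀ R) f s

/-- The ratio `q^n / (1 - q^n)²`. -/
noncomputable def ratio (q : R) (n : ℕ) : R := q ^ n * Ring.inverse ((1 - q ^ n) ^ 2)

theorem uTerm_eq_prod (q : R) {t : ℕ} (k : Fin t → ℕ+) : uTerm q k = ∏ i, ratio q (k i) := by
  simp only [uTerm, ratio, prod_mul_distrib, inverse_prod, prod_pow_eq_pow_sum]

theorem cTerm_eq_prod (q : R) {t : ℕ} (s : Fin t → ℕ+) :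
    cTerm q s = ∏ i, ratio q (2 * (s i : ℕ) - 1) := by
  simp only [cTerm, ratio, prod_mul_distrib, inverse_prod, prod_pow_eq_pow_sum]
  congr 2
  rw [Finset.sum_tsub_distrib _ fun i _ => by have := (s i).pos; omega]
  simp

theorem eq_mul_inverse {a b c : R} (hb : IsUnit b) (h : a * b = c) : a = c * Ring.inverse b := by
  rw [← h, mul_assoc, Ring.mul_inverse_cancel b hb, mul_one]

end Inverse

/-! ### Euler products and the first two identities. -/

section NormedRing
variable {R : Type*} [NormedCommRing R] [CompleteSpace R]

/-- Inversion is continuous at the unit `1`, so all but finitely many of the inverses are bounded.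
-/
theorem summable_norm_mul_inverse {ι : Type*} {f g : ι → R} (hf : Summable fun i => ‖f i‖)
    (hg : Tendsto g cofinite (𝓝 1)) : Summable fun i => ‖f i * Ring.inverse (g i)‖ := by
  have h1 : Tendsto (fun i => ‖Ring.inverse (g i)‖) cofinite (𝓝 ‖(1 : R)‖) := by
    have := (NormedRing.inverse_continuousAt (1 : Rˣ)).tendsto
    rw [Ring.inverse_unit] at this
    simpa using (this.comp hg).norm
  refine Summable.of_norm_bounded_eventually (hf.mul_right (‖(1 : R)‖ + 1)) ?_
  filter_upwards [h1.eventually_le_const (lt_add_one _)] with i hi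
  rw [norm_norm]
  exact (norm_mul_le _ _).trans (by gcongr)

variable [NormOneClass R]

theorem tprod_one_add_mul_tprod_inverse {ι : Type*} {f : ι → R} (hf : Summable fun i => ‖f i‖)
    (hu : ∀ i, IsUnit (1 + f i)) : (∏' i, (1 + f i)) * ∏' i, Ring.inverse (1 + f i) = 1 := by
  have h1 : Tendsto (fun i => 1 + f i) cofinite (𝓝 1) := by
    simpa using (hf.of_norm.tendsto_cofinite_zero).const_add 1
  have e : ∀ i, Ring.inverse (1 + f i) = 1 + -(f i * Ring.inverse (1 + f i)) := by
    intro i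
    linear_combination (Ring.mul_inverse_cancel _ (hu i))
  have hm : Multipliable fun i => Ring.inverse (1 + f i) := by
    simp_rw [funext e]
    exact multipliable_one_add_of_summable (by simpa using summable_norm_mul_inverse hf h1)
  rw [← (multipliable_one_add_of_summable hf).tprod_mul hm]
  simp [Ring.mul_inverse_cancel _ (hu _)]

theorem isUnit_tprod_one_add {ι : Type*} {f : ι → R} (hf : Summable fun i => ‖f i‖)
    (hu : ∀ i, IsUnit (1 + f i)) : IsUnit (∏' i, (1 + f i)) :=
  IsUnit.of_mul_eq_one _ (tprod_one_add_mul_tprod_inverse hf hu)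

variable {q : R} (hq : ‖q‖ < 1)
include hq

omit [CompleteSpace R] in
theorem norm_pow_lt_one {n : ℕ} (hn : 1 ≤ n) : ‖q ^ n‖ < 1 :=
  (norm_pow_le q n).trans_lt (pow_lt_one₀ (norm_nonneg _) hq (by omega))

theorem isUnit_one_sub_pow {n : ℕ} (hn : 1 ≤ n) : IsUnit (1 - q ^ n) :=
  isUnit_one_sub_of_norm_lt_one (norm_pow_lt_one hq hn)

omit [CompleteSpace R] [NormOneClass R] in
theorem summable_norm_pow_comp {ι : Type*} {e : ι → ℕ} (he : Function.Injective e) :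
    Summable fun i => ‖q ^ e i‖ :=
  (summable_norm_geometric_of_norm_lt_one hq).comp_injective he

omit [NormOneClass R] in
theorem summable_norm_ratio {ι : Type*} {e : ι → ℕ} (he : Function.Injective e) :
    Summable fun i => ‖ratio q (e i)‖ := by
  refine summable_norm_mul_inverse (summable_norm_pow_comp hq he) ?_
  have := (((summable_norm_pow_comp hq he).of_norm.tendsto_cofinite_zero).const_sub 1).pow 2
  simpa using this

/-- The numerator `1 - y + y^2` of `1 + y/(1-y)^2` is the sixth cyclotomic polynomial, equal to
`(1-y)(1-y^6)/((1-y^2)(1-y^3))`. -/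
theorem one_add_ratio_mul {n : ℕ} (hn : 1 ≤ n) :
    (1 + ratio q n) * ((1 - q ^ n) * (1 - q ^ (2 * n)) * (1 - q ^ (3 * n))) = 1 - q ^ (6 * n) := by
  have h := Ring.mul_inverse_cancel _ ((isUnit_one_sub_pow hq hn).pow 2)
  have e : ∀ m, q ^ (m * n) = (q ^ n) ^ m := fun m => by rw [← pow_mul, mul_comm]
  rw [ratio, e, e, e]
  generalize q ^ n = y at *
  generalize Ring.inverse ((1 - y) ^ 2) = z at *
  linear_combination (y * (1 + y) * (1 - y ^ 3)) * h

theorem hasProd_one_sub_pow {ι : Type*} {e : ι → ℕ} (he : Function.Injective e) :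
    HasProd (fun i => 1 - q ^ e i) (∏' i, (1 - q ^ e i)) := by
  simp_rw [sub_eq_add_neg]
  exact (multipliable_one_add_of_summable (by simpa using summable_norm_pow_comp hq he)).hasProd

theorem isUnit_tprod_one_sub_pow {ι : Type*} {e : ι → ℕ} (he : Function.Injective e)
    (h1 : ∀ i, 1 ≤ e i) : IsUnit (∏' i, (1 - q ^ e i)) := by
  simp_rw [sub_eq_add_neg]
  refine isUnit_tprod_one_add (by simpa using summable_norm_pow_comp hq he) fun i => ?_
  rw [← sub_eq_add_neg]
  exact isUnit_one_sub_pow hq (h1 i)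

omit hq [CompleteSpace R] [NormOneClass R] in
theorem euler_pow (m : ℕ) : euler (q ^ m) = ∏' n : ℕ, (1 - q ^ (m * (n + 1))) := by
  refine tprod_congr fun n => ?_
  rw [← pow_mul, ← pow_add, mul_add, mul_one, add_comm]

omit hq [CompleteSpace R] [NormOneClass R] in
theorem injective_mul_add {m : ℕ} (hm : 1 ≤ m) {a : ℕ} (ha : 1 ≤ a) (b : ℕ) :
    Function.Injective fun n : ℕ => m * (a * n + b) := fun x y h => by
  have h1 := Nat.eq_of_mul_eq_mul_left (by omega) h
  exact Nat.eq_of_mul_eq_mul_left (by omega : 0 < a) (by omega)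

theorem hasProd_euler {m : ℕ} (hm : 1 ≤ m) :
    HasProd (fun n : ℕ => 1 - q ^ (m * (n + 1))) (euler (q ^ m)) := by
  rw [euler_pow]
  exact hasProd_one_sub_pow hq (by simpa using injective_mul_add hm le_rfl 1)

theorem isUnit_euler {m : ℕ} (hm : 1 ≤ m) : IsUnit (euler (q ^ m)) := by
  rw [euler_pow]
  exact isUnit_tprod_one_sub_pow hq (by simpa using injective_mul_add hm le_rfl 1)
    fun i => Nat.mul_pos hm (by omega)

theorem multipliable_euler {m : ℕ} (hm : 1 ≤ m) :
    Multipliable (fun n : ℕ => 1 - q ^ m * (q ^ m) ^ n) := by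
  refine (hasProd_euler hq hm).multipliable.congr fun n => ?_
  rw [← pow_mul, ← pow_add, mul_add, mul_one, add_comm]

omit hq [CompleteSpace R] [NormOneClass R] in
/-- The product of the odd factors of `(q^m; q^m)_∞`. -/
noncomputable def oddEuler (q : R) (m : ℕ) : R := ∏' n : ℕ, (1 - q ^ (m * (2 * n + 1)))

theorem hasProd_oddEuler {m : ℕ} (hm : 1 ≤ m) :
    HasProd (fun n : ℕ => 1 - q ^ (m * (2 * n + 1))) (oddEuler q m) :=
  hasProd_one_sub_pow hq (injective_mul_add hm (by omega) 1)

theorem oddEuler_mul_euler {m : ℕ} (hm : 1 ≤ m) :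
    oddEuler q m * euler (q ^ (2 * m)) = euler (q ^ m) := by
  refine HasProd.unique (HasProd.even_mul_odd (f := fun n : ℕ => 1 - q ^ (m * (n + 1)))
    (hasProd_oddEuler hq hm) ?_) (hasProd_euler hq hm)
  convert hasProd_euler hq (m := 2 * m) (by omega) using 4
  ring

theorem hasProd_one_add_ratio {ι : Type*} {e : ι → ℕ} (he : Function.Injective e) :
    HasProd (fun i => 1 + ratio q (e i)) (∏' i, (1 + ratio q (e i))) :=
  (multipliable_one_add_of_summable (summable_norm_ratio hq he)).hasProd

theorem tprod_one_add_ratio :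
    ∏' n : ℕ, (1 + ratio q (n + 1)) =
      euler (q ^ 6) * Ring.inverse (euler q * euler (q ^ 2) * euler (q ^ 3)) := by
  have u := fun m hm => isUnit_euler hq (m := m) hm
  have p := fun m hm => hasProd_euler hq (m := m) hm
  have u1 := u 1 le_rfl
  have p1 := p 1 le_rfl
  rw [pow_one] at u1 p1
  refine eq_mul_inverse ((u1.mul (u 2 (by norm_num))).mul (u 3 (by norm_num))) ?_
  refine HasProd.unique ((hasProd_one_add_ratio hq (add_left_injective 1)).mul
    ((p1.mul (p 2 (by norm_num))).mul (p 3 (by norm_num)))) ?_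
  convert p 6 (by norm_num) using 2 with n
  rw [one_mul]
  exact one_add_ratio_mul hq (by omega)

/-- Restricting to odd indices replaces each `(q^m)_∞` by its odd part `(q^m)_∞/(q^(2m))_∞`, for `m
= 1, 2, 3, 6`; the factors `(q^2)_∞` cancel. -/
theorem tprod_one_add_ratio_odd :
    ∏' n : ℕ, (1 + ratio q (2 * n + 1)) =
      euler (q ^ 4) * euler (q ^ 6) ^ 2 *
        Ring.inverse (euler q * euler (q ^ 3) * euler (q ^ 12)) := by
  have u := fun m hm => isUnit_euler hq (m := m) hm
  have p := fun m hm => hasProd_oddEuler hq (m := m) hm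
  have u1 := u 1 le_rfl
  have e1 := oddEuler_mul_euler hq (m := 1) le_rfl
  have e2 := oddEuler_mul_euler hq (m := 2) (by norm_num)
  have e3 := oddEuler_mul_euler hq (m := 3) (by norm_num)
  have e6 := oddEuler_mul_euler hq (m := 6) (by norm_num)
  norm_num at e1 e2 e3 e6
  rw [pow_one] at u1
  refine eq_mul_inverse ((u1.mul (u 3 (by norm_num))).mul (u 12 (by norm_num))) ?_
  have key : (∏' n : ℕ, (1 + ratio q (2 * n + 1))) *
      (oddEuler q 1 * oddEuler q 2 * oddEuler q 3) = oddEuler q 6 := by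
    have hi : Function.Injective fun n : ℕ => 2 * n + 1 := fun a b h => by simpa using h
    refine HasProd.unique ((hasProd_one_add_ratio hq hi).mul
      (((p 1 le_rfl).mul (p 2 (by norm_num))).mul (p 3 (by norm_num)))) ?_
    convert p 6 (by norm_num) using 2 with n
    rw [one_mul]
    exact one_add_ratio_mul hq (by omega)
  rw [← e1, ← e2, ← e3, sq]
  -- Only the last `euler (q ^ 6)` is expanded: the other on the right matches the one that `e3` put
  -- on the left.
  nth_rewrite 3 [← e6]
  rw [← key]
  ring

theorem summable_uTerm_strictMono (t : ℕ) :
    Summable fun k : {k : Fin t → ℕ+ // StrictMono k} => uTerm q k.1 := by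
  simp_rw [uTerm_eq_prod]
  exact ((summable_norm_strictChain _ (summable_norm_ratio hq PNat.coe_injective)).comp_injective
    (sigma_mk_injective (i := t))).of_norm

theorem summable_cTerm (t : ℕ) :
    Summable fun s : {s : Fin t → ℕ+ // StrictMono s} => cTerm q s.1 := by
  simp_rw [cTerm_eq_prod]
  exact ((summable_norm_strictChain (fun s : ℕ+ => ratio q (2 * (s : ℕ) - 1))
    (summable_norm_ratio hq injective_two_mul_sub_one)).comp_injective
    (sigma_mk_injective (i := t))).of_norm

theorem summable_uTerm_monotone (t : ℕ) :
    Summable fun k : {k : Fin t → ℕ+ // Monotone k} => uTerm q k.1 := by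
  simp_rw [uTerm_eq_prod]
  exact summable_weakChain (fun k : ℕ+ => ratio q k) (summable_norm_ratio hq PNat.coe_injective) t

theorem hasSum_U : HasSum (fun t : ℕ => U t q)
    (euler (q ^ 6) * Ring.inverse (euler q * euler (q ^ 2) * euler (q ^ 3))) := by
  simp_rw [U, uTerm_eq_prod]
  rw [← tprod_one_add_ratio hq,
    ← tprod_pnat_eq_tprod_succ (f := fun n : ℕ => 1 + ratio q n)]
  exact hasSum_strictChain (fun k : ℕ+ => ratio q k) (summable_norm_ratio hq PNat.coe_injective)

theorem hasSum_C : HasSum (fun t : ℕ => C t q)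
    (euler (q ^ 4) * euler (q ^ 6) ^ 2 *
      Ring.inverse (euler q * euler (q ^ 3) * euler (q ^ 12))) := by
  simp_rw [C, cTerm_eq_prod]
  rw [← tprod_one_add_ratio_odd hq]
  have : ∏' n : ℕ, (1 + ratio q (2 * n + 1)) = ∏' n : ℕ+, (1 + ratio q (2 * (n : ℕ) - 1)) := by
    rw [tprod_pnat_eq_tprod_succ (f := fun n : ℕ => 1 + ratio q (2 * n - 1))]
    rfl
  rw [this]
  exact hasSum_strictChain (fun s : ℕ+ => ratio q (2 * (s : ℕ) - 1))
    (summable_norm_ratio hq injective_two_mul_sub_one)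

end NormedRing
-- Lagrange interpolation and the finite partial fraction identity.
section Field
variable {K : Type*} [Field K]

/-- The finite product `(q;q)_n`. -/
def qFac {R : Type*} [CommRing R] (q : R) (n : ℕ) : R := ∏ k ∈ range n, (1 - q ^ (k + 1))

theorem qFac_succ {R : Type*} [CommRing R] (q : R) (n : ℕ) :
    qFac q (n + 1) = qFac q n * (1 - q ^ (n + 1)) := prod_range_succ _ _

/-- The quadratic `1 - 3 q^n + q^(2n)`. -/
def quad {R : Type*} [CommRing R] (q : R) (n : ℕ) : R := 1 - 3 * q ^ n + q ^ (2 * n)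

theorem qFac_ne_zero {q : K} (h1 : ∀ n, 1 ≤ n → 1 - q ^ n ≠ 0) (n : ℕ) : qFac q n ≠ 0 :=
  prod_ne_zero_iff.2 fun k _ => h1 (k + 1) (by omega)

/-- A node of the interpolation. -/
noncomputable def node (q : K) (n : ℕ) : K := q ^ (n + 1) + (q ^ (n + 1))⁻¹

/-- The factorization `z_a - z_b = q^(-a) (1-q^(a-b)) (1-q^(a+b))` for `z_n = q^n + q^(-n)`, with `a
= i+d+2` and `b = i+1`. -/
theorem node_sub_node {q : K} (hq : q ≠ 0) (i d : ℕ) :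
    node q (i + d + 1) - node q i =
      (q ^ (i + d + 2))⁻¹ * ((1 - q ^ (d + 1)) * (1 - q ^ (2 * i + d + 3))) := by
  unfold node
  field_simp
  ring

theorem three_sub_node {q : K} (hq : q ≠ 0) (n : ℕ) :
    3 - node q n = -((q ^ (n + 1))⁻¹ * quad q (n + 1)) := by
  unfold node quad
  field_simp
  ring

theorem node_injective {q : K} (hq : q ≠ 0) (h1 : ∀ n, 1 ≤ n → 1 - q ^ n ≠ 0) :
    Function.Injective (node q) := by
  have key : ∀ i d, node q (i + d + 1) ≠ node q i := by
    intro i d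
    rw [← sub_ne_zero, node_sub_node hq]
    exact mul_ne_zero (inv_ne_zero (pow_ne_zero _ hq)) (mul_ne_zero (h1 _ (by omega)) (h1 _ (by omega)))
  intro a b h
  rcases lt_trichotomy a b with hab | hab | hab
  · obtain ⟨d, rfl⟩ := Nat.exists_eq_add_of_lt hab
    exact absurd h.symm (key a d)
  · exact hab
  · obtain ⟨d, rfl⟩ := Nat.exists_eq_add_of_lt hab
    exact absurd h (key b d)

theorem node_factor_of_lt {q : K} (hq : q ≠ 0) (h1 : ∀ n, 1 ≤ n → 1 - q ^ n ≠ 0) (j d : ℕ) :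
    (node q (j + d + 1) - node q j)⁻¹ * (3 - node q j) =
      -q ^ (d + 1) * quad q (j + 1) / ((1 - q ^ (d + 1)) * (1 - q ^ (2 * j + d + 3))) := by
  rw [node_sub_node hq, three_sub_node hq]
  have a := h1 (d + 1) (by omega)
  have b := h1 (2 * j + d + 3) (by omega)
  field_simp
  ring

theorem node_factor_of_gt {q : K} (hq : q ≠ 0) (h1 : ∀ n, 1 ≤ n → 1 - q ^ n ≠ 0) (i d : ℕ) :
    (node q i - node q (i + d + 1))⁻¹ * (3 - node q (i + d + 1)) =
      quad q (i + d + 2) / ((1 - q ^ (d + 1)) * (1 - q ^ (2 * i + d + 3))) := by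
  rw [← neg_sub (node q (i + d + 1)), node_sub_node hq, three_sub_node hq]
  have a := h1 (d + 1) (by omega)
  have b := h1 (2 * i + d + 3) (by omega)
  field_simp

/-- The nodes below `i` contribute denominators with exponents `1, …, i` and `i+2, …, 2i+1`.
Completing them to `qFac q (2 * i + 2)` puts the missing exponents `i+1` and `2i+2` in the
numerator. -/
theorem prod_node_factor_range {q : K} (hq : q ≠ 0) (h1 : ∀ n, 1 ≤ n → 1 - q ^ n ≠ 0) (i : ℕ) :
    ∏ j ∈ range i, ((node q i - node q j)⁻¹ * (3 - node q j)) =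
      (-1) ^ i * q ^ ((i + 1).choose 2) * (1 - q ^ (i + 1)) * (1 - q ^ (2 * (i + 1))) *
        (∏ j ∈ range i, quad q (j + 1)) / qFac q (2 * i + 2) := by
  have e : ∀ j ∈ range i, (node q i - node q j)⁻¹ * (3 - node q j) =
      -1 * q ^ (i - j) * quad q (j + 1) / ((1 - q ^ (i - j)) * (1 - q ^ (i + 1 + j + 1))) := by
    intro j hj
    obtain ⟨d, rfl⟩ := Nat.exists_eq_add_of_lt (mem_range.1 hj)
    rw [node_factor_of_lt hq h1, show j + d + 1 - j = d + 1 by omega,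
      show 2 * j + d + 3 = j + d + 1 + 1 + j + 1 by omega, neg_one_mul]
  rw [prod_congr rfl e, prod_div_distrib, prod_mul_distrib, prod_mul_distrib, prod_mul_distrib,
    prod_const, card_range, prod_pow_eq_pow_sum]
  have s1 : ∑ j ∈ range i, (i - j) = (i + 1).choose 2 := by
    clear e
    induction i with
    | zero => simp
    | succ i ih =>
      rw [sum_range_succ', Nat.choose_succ_succ' (i + 1) 1, ← ih, Nat.choose_one_right]
      simp [add_comm]
  have s2 : ∏ j ∈ range i, (1 - q ^ (i - j)) = qFac q i := by
    rw [qFac, ← prod_range_reflect]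
    refine prod_congr rfl fun j hj => ?_
    rw [show i - (i - 1 - j) = j + 1 by have := mem_range.1 hj; omega]
  have s3 : qFac q (2 * i + 2) =
      qFac q (i + 1) * (∏ j ∈ range i, (1 - q ^ (i + 1 + j + 1))) * (1 - q ^ (2 * (i + 1))) := by
    rw [show 2 * i + 2 = (i + 1 + i) + 1 by omega, qFac_succ, qFac, qFac, prod_range_add,
      show i + 1 + i + 1 = 2 * (i + 1) by omega]
  rw [s1, s2, s3, qFac_succ]
  have a := h1 (i + 1) (by omega)
  have b := h1 (2 * (i + 1)) (by omega)
  have c := qFac_ne_zero h1 i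
  have d : ∏ j ∈ range i, (1 - q ^ (i + 1 + j + 1)) ≠ 0 :=
    prod_ne_zero_iff.2 fun k _ => h1 _ (by omega)
  field_simp

/-- Induction on the number `d` of nodes above `i`: each adds no sign or power of `q` and extends
both `qFac` by one factor. The division by `quad q (i + 1)` removes `j = i` from the full product.
-/
theorem prod_node_factor {q : K} (hq : q ≠ 0) (h1 : ∀ n, 1 ≤ n → 1 - q ^ n ≠ 0)
    (h2 : ∀ n, 1 ≤ n → quad q n ≠ 0) (i d : ℕ) :
    ∏ j ∈ (range (i + 1 + d)).erase i, ((node q i - node q j)⁻¹ * (3 - node q j)) =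
      (-1) ^ i * q ^ ((i + 1).choose 2) * (1 - q ^ (i + 1)) * (1 - q ^ (2 * (i + 1))) *
        (∏ j ∈ range (i + 1 + d), quad q (j + 1)) /
          (quad q (i + 1) * (qFac q d * qFac q (2 * i + 2 + d))) := by
  induction d with
  | zero =>
    have h := h2 (i + 1) (by omega)
    rw [add_zero, range_add_one, erase_insert notMem_range_self, prod_node_factor_range hq h1,
      prod_insert notMem_range_self, add_zero]
    simp only [qFac, range_zero, prod_empty, one_mul]
    field_simp
  | succ d ih =>
    rw [← add_assoc, range_add_one, erase_insert_of_ne (by omega), prod_insert (by simp),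
      prod_insert notMem_range_self, ih, ← add_assoc, qFac_succ, qFac_succ,
      show i + 1 + d = i + d + 1 by omega, node_factor_of_gt hq h1,
      show 2 * i + 2 + d + 1 = 2 * i + d + 3 by omega]
    have a := h1 (d + 1) (by omega)
    have b := h1 (2 * i + d + 3) (by omega)
    have c := h2 (i + 1) (by omega)
    have e := qFac_ne_zero h1 d
    have f := qFac_ne_zero h1 (2 * i + 2 + d)
    field_simp

theorem sum_partialFraction {q : K} (hq : q ≠ 0) (h1 : ∀ n, 1 ≤ n → 1 - q ^ n ≠ 0)
    (h2 : ∀ n, 1 ≤ n → quad q n ≠ 0) {N : ℕ} (hN : 1 ≤ N) :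
    ∏ j ∈ range N, ((1 - q ^ (j + 1)) ^ 2 / quad q (j + 1)) =
      ∑ i ∈ range N, (-1) ^ i * (1 - q ^ (i + 1)) * (1 - q ^ (2 * (i + 1))) *
        q ^ ((i + 1).choose 2) / quad q (i + 1) *
          (qFac q N ^ 2 / (qFac q (N - 1 - i) * qFac q (N + i + 1))) := by
  have hP : ∏ j ∈ range N, quad q (j + 1) ≠ 0 :=
    prod_ne_zero_iff.2 fun k _ => h2 _ (by omega)
  -- The basis polynomials sum to `1`; at `3` their factors are the node factors computed above.
  have h := congrArg (Polynomial.eval 3) (Lagrange.sum_basis (s := range N) (v := node q)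
    (node_injective hq h1).injOn ⟨0, mem_range.2 hN⟩)
  rw [Polynomial.eval_finsetSum, Polynomial.eval_one] at h
  rw [prod_div_distrib, prod_pow]
  change qFac q N ^ 2 / _ = _
  have h' : qFac q N ^ 2 = ∑ i ∈ range N,
      qFac q N ^ 2 * Polynomial.eval 3 (Lagrange.basis (range N) (node q) i) := by
    rw [← mul_sum, h, mul_one]
  nth_rewrite 1 [h']
  rw [sum_div]
  refine sum_congr rfl fun i hi => ?_
  obtain ⟨d, rfl⟩ := Nat.exists_eq_add_of_le (Nat.succ_le_of_lt (mem_range.1 hi))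
  rw [Nat.succ_eq_add_one] at *
  rw [Lagrange.basis, Polynomial.eval_prod]
  simp only [Lagrange.basisDivisor, Polynomial.eval_mul, Polynomial.eval_C, Polynomial.eval_sub,
    Polynomial.eval_X]
  rw [prod_node_factor hq h1 h2]
  rw [show i + 1 + d - 1 - i = d by omega, show i + 1 + d + i + 1 = 2 * i + 2 + d by omega]
  have c := h2 (i + 1) (by omega)
  have e := qFac_ne_zero h1 d
  have f := qFac_ne_zero h1 (2 * i + 2 + d)
  field_simp

end Field

theorem map_inverse_of_isUnit {R K : Type*} [CommRing R] [Field K] (f : R →+* K) {u : R}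
    (hu : IsUnit u) : f (Ring.inverse u) = (f u)⁻¹ := by
  refine eq_inv_of_mul_eq_one_left ?_
  rw [← map_mul, Ring.inverse_mul_cancel u hu, map_one]

/-- The summand `starTerm q (i + 1)`, indexed by natural numbers. -/
noncomputable def starTermNat {R : Type*} [CommRing R] (q : R) (i : ℕ) : R :=
  (-1) ^ i * (1 - q ^ (i + 1)) * (1 - q ^ (2 * (i + 1))) * q ^ ((i + 1).choose 2) *
    Ring.inverse (quad q (i + 1))

theorem starTerm_eq {R : Type*} [CommRing R] (q : R) (n : ℕ+) :
    starTerm q n = starTermNat q ((n : ℕ) - 1) := by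
  rw [starTermNat, Nat.sub_add_cancel n.pos]
  rfl

/-- Both sides embed in the fraction field, where the units become nonzero elements and
`sum_partialFraction` applies. -/
theorem prod_quotient_eq_sum {R : Type*} [CommRing R] [IsDomain R] {q : R}
    (h1 : ∀ n, 1 ≤ n → IsUnit (1 - q ^ n)) (h2 : ∀ n, 1 ≤ n → IsUnit (quad q n))
    {N : ℕ} (hN : 1 ≤ N) :
    ∏ j ∈ range N, ((1 - q ^ (j + 1)) ^ 2 * Ring.inverse (quad q (j + 1))) =
      ∑ i ∈ range N, starTermNat q i *
          (qFac q N ^ 2 * Ring.inverse (qFac q (N - 1 - i) * qFac q (N + i + 1))) := by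
  have hF : ∀ n, IsUnit (qFac q n) := fun n => by
    unfold qFac
    exact (IsUnit.prod_iff).2 fun k _ => h1 (k + 1) (by omega)
  -- The nodes involve `q⁻¹`, so `q = 0` is separate; there only `i = 0` has exponent `(i+1).choose
  -- 2 = 0`.
  by_cases hq : q = 0
  · subst hq
    rw [sum_eq_single_of_mem 0 (mem_range.2 hN)]
    · simp [starTermNat, qFac, quad]
    · intro i _ hi
      have : (i + 1).choose 2 ≠ 0 := (Nat.choose_pos (by omega)).ne'
      rw [starTermNat, zero_pow this]
      simp
  · let f := algebraMap R (FractionRing R)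
    have hf : Function.Injective f := IsFractionRing.injective R (FractionRing R)
    have mF : ∀ n, f (qFac q n) = qFac (f q) n := fun n => by simp [qFac]
    have mQ : ∀ n, f (quad q n) = quad (f q) n := fun n => by
      simp [quad, show f 3 = 3 from map_ofNat f 3]
    apply hf
    have key := sum_partialFraction (q := f q) (by simpa [f] using hq)
      (fun n hn => by simpa using ((h1 n hn).map f).ne_zero)
      (fun n hn => by rw [← mQ]; exact ((h2 n hn).map f).ne_zero) hN
    simp only [map_prod, map_sum, map_mul, map_pow, map_sub, map_one, starTermNat, map_neg,
      map_inverse_of_isUnit f (h2 _ (Nat.succ_pos _)),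
      map_inverse_of_isUnit f ((hF _).mul (hF _)), mF, mQ]
    simpa only [div_eq_mul_inv] using key

/-! ### The limit `N → ∞` and the starred identity. -/

section Star
variable {R : Type*} [NormedCommRing R] [CompleteSpace R] [NormOneClass R] {q : R} (hq : ‖q‖ < 1)
include hq

theorem summable_norm_starTermNat : Summable fun i : ℕ => ‖starTermNat q i‖ := by
  refine summable_norm_mul_inverse (f := fun i : ℕ => (-1) ^ i * (1 - q ^ (i + 1)) *
    (1 - q ^ (2 * (i + 1))) * q ^ ((i + 1).choose 2)) (g := fun i => quad q (i + 1)) ?_ ?_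
  · refine Summable.of_nonneg_of_le (fun _ => norm_nonneg _) (fun i => ?_)
      -- The constant bounds the sign by `1` and the two factors `1 - q^n` by `2` each; the
      -- geometric term uses `(i+1).choose 2 ≥ i`.
      ((summable_geometric_of_lt_one (norm_nonneg q) hq).mul_left (1 * 2 * 2))
    have two : ∀ n, ‖1 - q ^ (n + 1)‖ ≤ 2 := fun n => by
      refine (norm_sub_le _ _).trans ?_
      rw [norm_one]
      linarith [norm_pow_lt_one hq (Nat.succ_pos n)]
    have hs : ‖((-1) ^ i : R)‖ ≤ 1 := (norm_pow_le _ _).trans (by simp)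
    have hc : ‖q ^ ((i + 1).choose 2)‖ ≤ ‖q‖ ^ i := by
      refine (norm_pow_le _ _).trans (pow_le_pow_of_le_one (norm_nonneg _) hq.le ?_)
      rw [Nat.choose_succ_succ' i 1, Nat.choose_one_right]
      omega
    refine (norm_mul_le _ _).trans (mul_le_mul ?_ hc (norm_nonneg _) (by norm_num))
    refine (norm_mul_le _ _).trans (mul_le_mul ?_ (two (2 * i + 1)) (norm_nonneg _) (by norm_num))
    exact (norm_mul_le _ _).trans (mul_le_mul hs (two i) (norm_nonneg _) (by norm_num))
  · have h1 := (summable_norm_pow_comp hq (e := fun i : ℕ => i + 1)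
      (add_left_injective 1)).of_norm.tendsto_cofinite_zero
    have h2 := (summable_norm_pow_comp hq (e := fun i : ℕ => 2 * (i + 1))
      (by simpa using injective_mul_add (m := 2) (by norm_num) le_rfl 1)).of_norm.tendsto_cofinite_zero
    simpa [quad] using ((h1.const_mul 3).const_sub 1).add h2

theorem summable_starTerm : Summable fun n : ℕ+ => starTerm q n := by
  simp_rw [starTerm_eq]
  exact (summable_norm_starTermNat hq).of_norm.comp_injective (i := fun n : ℕ+ => (n : ℕ) - 1)
    fun a b h => PNat.coe_injective (by have := a.pos; have := b.pos; simp only at h; omega)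

omit hq [CompleteSpace R] [NormOneClass R] in
theorem tsum_starTerm : ∑' n : ℕ+, starTerm q n = ∑' i : ℕ, starTermNat q i := by
  simp_rw [starTerm_eq]
  exact tsum_pnat_eq_tsum_succ (f := fun n : ℕ => starTermNat q (n - 1))

theorem tendsto_qFac : Tendsto (qFac q) atTop (𝓝 (euler q)) := by
  have := (hasProd_euler hq (m := 1) le_rfl).tendsto_prod_nat
  simp only [one_mul, pow_one] at this
  exact this

theorem tendsto_inverse_qFac :
    Tendsto (fun n => Ring.inverse (qFac q n)) atTop (𝓝 (Ring.inverse (euler q))) := by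
  have hu := isUnit_euler hq (m := 1) le_rfl
  rw [pow_one] at hu
  obtain ⟨u, hu⟩ := hu
  have := (NormedRing.inverse_continuousAt u).tendsto
  rw [hu] at this
  exact this.comp (tendsto_qFac hq)

/-- Since `quad q n = (1 - q^n)^2 (1 - ratio q n)`, the bound on the ratio makes both factors units.
-/
theorem isUnit_quad (hr : ∀ n, 1 ≤ n → ‖ratio q n‖ < 1) {n : ℕ} (hn : 1 ≤ n) :
    IsUnit (quad q n) := by
  have h := Ring.mul_inverse_cancel _ ((isUnit_one_sub_pow hq hn).pow 2)
  have e : quad q n = (1 - q ^ n) ^ 2 * (1 - ratio q n) := by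
    rw [quad, ratio, mul_comm 2 n, pow_mul]
    linear_combination q ^ n * h
  rw [e]
  exact ((isUnit_one_sub_pow hq hn).pow 2).mul (isUnit_one_sub_of_norm_lt_one (hr n hn))

theorem inverse_one_sub_ratio (hr : ∀ n, 1 ≤ n → ‖ratio q n‖ < 1) {n : ℕ} (hn : 1 ≤ n) :
    Ring.inverse (1 - ratio q n) = (1 - q ^ n) ^ 2 * Ring.inverse (quad q n) := by
  have h := Ring.mul_inverse_cancel _ ((isUnit_one_sub_pow hq hn).pow 2)
  refine (eq_mul_inverse (isUnit_quad hq hr hn) ?_)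
  have e : quad q n = (1 - ratio q n) * (1 - q ^ n) ^ 2 := by
    rw [quad, ratio, mul_comm 2 n, pow_mul]
    linear_combination q ^ n * h
  rw [e, ← mul_assoc, Ring.inverse_mul_cancel _ (isUnit_one_sub_of_norm_lt_one (hr n hn)), one_mul]

theorem tprod_inverse_one_sub_ratio [IsDomain R] (hr : ∀ n, 1 ≤ n → ‖ratio q n‖ < 1) :
    ∏' k : ℕ+, Ring.inverse (1 - ratio q k) = ∑' n : ℕ+, starTerm q n := by
  rw [tsum_starTerm, tprod_pnat_eq_tprod_succ (f := fun n : ℕ => Ring.inverse (1 - ratio q n))]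
  have hp := (hasProd_inverse_one_sub (fun n : ℕ => ratio q (n + 1))
    (fun n => hr _ (Nat.succ_pos n)) (summable_norm_ratio hq (add_left_injective 1))).multipliable
  have hP := hp.hasProd.tendsto_prod_nat
  obtain ⟨A, hA⟩ := (Metric.isBounded_range_of_tendsto _ (tendsto_qFac hq)).exists_norm_le
  obtain ⟨B, hB⟩ := (Metric.isBounded_range_of_tendsto _ (tendsto_inverse_qFac hq)).exists_norm_le
  replace hA : ∀ n, ‖qFac q n‖ ≤ A := fun n => hA _ ⟨n, rfl⟩
  replace hB : ∀ n, ‖Ring.inverse (qFac q n)‖ ≤ B := fun n => hB _ ⟨n, rfl⟩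
  -- The finite sums are extended by zero to series over all `i`, with the common majorant
  -- `‖starTermNat q i‖ A² B²`.
  let F : ℕ → ℕ → R := fun N i => if i < N then starTermNat q i *
    (qFac q N ^ 2 * Ring.inverse (qFac q (N - 1 - i) * qFac q (N + i + 1))) else 0
  have hA0 : 0 ≤ A := (norm_nonneg _).trans (hA 0)
  have hB0 : 0 ≤ B := (norm_nonneg _).trans (hB 0)
  have hS : Tendsto (fun N => ∑' i, F N i) atTop (𝓝 (∑' i, starTermNat q i)) := by
    refine tendsto_tsum_of_dominated_convergence
      ((summable_norm_starTermNat hq).mul_right (A ^ 2 * (B * B))) (fun i => ?_)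
      (Eventually.of_forall fun N i => ?_)
    · have t1 : Tendsto (fun N => N - 1 - i) atTop atTop := by
        simp_rw [Nat.sub_sub]
        exact tendsto_sub_atTop_nat _
      have t2 : Tendsto (fun N => N + i + 1) atTop atTop :=
        tendsto_add_atTop_nat (i + 1)
      have h := (((tendsto_qFac hq).pow 2).mul (((tendsto_inverse_qFac hq).comp t1).mul
        ((tendsto_inverse_qFac hq).comp t2))).const_mul (starTermNat q i)
      have hu := isUnit_euler hq (m := 1) le_rfl
      rw [pow_one] at hu
      have e : euler q ^ 2 * (Ring.inverse (euler q) * Ring.inverse (euler q)) = 1 := by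
        linear_combination (euler q * Ring.inverse (euler q) + 1) * Ring.mul_inverse_cancel _ hu
      rw [e, mul_one] at h
      refine h.congr' ?_
      filter_upwards [eventually_gt_atTop i] with N hN
      simp only [F, if_pos hN, Ring.mul_inverse_rev, Function.comp_apply]
      ring
    · simp only [F]
      split_ifs with h
      · refine (norm_mul_le _ _).trans ?_
        gcongr
        refine (norm_mul_le _ _).trans ?_
        gcongr
        · exact (norm_pow_le _ _).trans (by gcongr; exact hA N)
        · rw [Ring.mul_inverse_rev]
          exact (norm_mul_le _ _).trans (mul_le_mul (hB _) (hB _) (norm_nonneg _) hB0)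
      · rw [norm_zero]
        positivity
  refine tendsto_nhds_unique hP (hS.congr' ?_)
  filter_upwards [eventually_ge_atTop 1] with N hN
  rw [tsum_eq_sum (s := range N) fun i hi => if_neg (by simpa using hi)]
  rw [prod_congr rfl fun n _ => inverse_one_sub_ratio hq hr (Nat.succ_pos n),
    prod_quotient_eq_sum (fun n hn => isUnit_one_sub_pow hq hn)
    (fun n hn => isUnit_quad hq hr hn) hN]
  exact sum_congr rfl fun i hi => if_pos (mem_range.1 hi)

theorem hasSum_UStar [IsDomain R] (hr : ∀ n, 1 ≤ n → ‖ratio q n‖ < 1) :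
    HasSum (fun t : ℕ => UStar t q) (∑' n : ℕ+, starTerm q n) := by
  rw [← tprod_inverse_one_sub_ratio hq hr]
  simp_rw [UStar, uTerm_eq_prod]
  exact hasSum_weakChain (fun k : ℕ+ => ratio q k) (fun k => hr k k.pos)
    (summable_norm_ratio hq PNat.coe_injective)

end Star

/-- For `n ≥ 1` the factor `X^n` kills the constant coefficient, so the smallness condition is
automatic for power series. -/
theorem norm_ratio_lt_one_powerSeries {n : ℕ} (hn : 1 ≤ n) :
    orderNorm (ratio (PowerSeries.X : ℤ⟦X⟧) n) < 1 := by
  rw [← pow_zero (1 / 2 : ℝ), orderNorm_lt_iff]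
  intro i hi
  obtain rfl := Nat.le_zero.1 hi
  simp [ratio, (Nat.one_le_iff_ne_zero.1 hn)]

end MacMahon

theorem proposition5p2 :
    -- The identities between formal power series in the variable `q`.
    (∀ q : ℤ⟦X⟧, q = PowerSeries.X →
      -- all the series and products involved converge
      (∀ t : ℕ,
        Summable (fun k : {k : Fin t → ℕ+ // StrictMono k} => MacMahon.uTerm q k.1) ∧
        Summable (fun s : {s : Fin t → ℕ+ // StrictMono s} => MacMahon.cTerm q s.1) ∧
        Summable (fun k : {k : Fin t → ℕ+ // Monotone k} => MacMahon.uTerm q k.1)) ∧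
      (∀ m : ℕ, 1 ≤ m → Multipliable (fun n : ℕ => 1 - q ^ m * (q ^ m) ^ n)) ∧
      Summable (fun n : ℕ+ => MacMahon.starTerm q n) ∧
      -- the three identities
      HasSum (fun t : ℕ => MacMahon.U t q)
        (MacMahon.euler (q ^ 6) *
          Ring.inverse (MacMahon.euler q * MacMahon.euler (q ^ 2) * MacMahon.euler (q ^ 3))) ∧
      HasSum (fun t : ℕ => MacMahon.C t q)
        (MacMahon.euler (q ^ 4) * MacMahon.euler (q ^ 6) ^ 2 *
          Ring.inverse (MacMahon.euler q * MacMahon.euler (q ^ 3) * MacMahon.euler (q ^ 12))) ∧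
      HasSum (fun t : ℕ => MacMahon.UStar t q) (∑' n : ℕ+, MacMahon.starTerm q n)) ∧
    -- The identities between functions of a complex number `q` in the unit disc.
    (∀ q : ℂ, ‖q‖ < 1 →
      (∀ t : ℕ,
        Summable (fun k : {k : Fin t → ℕ+ // StrictMono k} => MacMahon.uTerm q k.1) ∧
        Summable (fun s : {s : Fin t → ℕ+ // StrictMono s} => MacMahon.cTerm q s.1) ∧
        Summable (fun k : {k : Fin t → ℕ+ // Monotone k} => MacMahon.uTerm q k.1)) ∧
      (∀ m : ℕ, 1 ≤ m → Multipliable (fun n : ℕ => 1 - q ^ m * (q ^ m) ^ n)) ∧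
      Summable (fun n : ℕ+ => MacMahon.starTerm q n) ∧
      HasSum (fun t : ℕ => MacMahon.U t q)
        (MacMahon.euler (q ^ 6) /
          (MacMahon.euler q * MacMahon.euler (q ^ 2) * MacMahon.euler (q ^ 3))) ∧
      HasSum (fun t : ℕ => MacMahon.C t q)
        (MacMahon.euler (q ^ 4) * MacMahon.euler (q ^ 6) ^ 2 /
          (MacMahon.euler q * MacMahon.euler (q ^ 3) * MacMahon.euler (q ^ 12))) ∧
      -- the sum over `t` of the starred series converges where `|q^n / (1-q^n)²| < 1` for all `n`
      ((∀ n : ℕ, 1 ≤ n → ‖q ^ n‖ < ‖1 - q ^ n‖ ^ 2) →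
        HasSum (fun t : ℕ => MacMahon.UStar t q) (∑' n : ℕ+, MacMahon.starTerm q n))) := by
  constructor
  · rintro q rfl
    -- The topology of this norm is the given one by definition, so the normed-ring results speak of
    -- coefficientwise convergence.
    let _ : NormedCommRing ℤ⟦X⟧ := MacMahon.normedPowerSeries
    have _ : CompleteSpace ℤ⟦X⟧ := PowerSeries.WithPiTopology.instCompleteSpace ℤ
    have _ : NormOneClass ℤ⟦X⟧ := ⟨by
      change MacMahon.orderNorm 1 = 1
      simp [MacMahon.orderNorm]⟩
    have hq : ‖(PowerSeries.X : ℤ⟦X⟧)‖ < 1 := by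
      change MacMahon.orderNorm PowerSeries.X < 1
      rw [← pow_zero (1 / 2 : ℝ), MacMahon.orderNorm_lt_iff]
      intro i hi
      obtain rfl := Nat.le_zero.1 hi
      simp
    exact ⟨fun t => ⟨MacMahon.summable_uTerm_strictMono hq t, MacMahon.summable_cTerm hq t,
      MacMahon.summable_uTerm_monotone hq t⟩, fun m hm => MacMahon.multipliable_euler hq hm,
      MacMahon.summable_starTerm hq, MacMahon.hasSum_U hq, MacMahon.hasSum_C hq,
      MacMahon.hasSum_UStar hq fun n hn => MacMahon.norm_ratio_lt_one_powerSeries hn⟩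
  · intro q hq
    refine ⟨fun t => ⟨MacMahon.summable_uTerm_strictMono hq t, MacMahon.summable_cTerm hq t,
      MacMahon.summable_uTerm_monotone hq t⟩, fun m hm => MacMahon.multipliable_euler hq hm,
      MacMahon.summable_starTerm hq, ?_, ?_, fun h => MacMahon.hasSum_UStar hq fun n hn => ?_⟩
    · simpa only [Ring.inverse_eq_inv', div_eq_mul_inv] using MacMahon.hasSum_U hq
    · simpa only [Ring.inverse_eq_inv', div_eq_mul_inv] using MacMahon.hasSum_C hq
    · have h0 := h n hn
      rw [MacMahon.ratio, Ring.inverse_eq_inv', norm_mul, norm_inv, norm_pow (1 - q ^ n),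
        ← div_eq_mul_inv]
      exact (div_lt_one ((norm_nonneg _).trans_lt h0)).2 h0
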